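/- Let $\mathcal G$ be a weighted directed graph on the nodes $1,\dots,N$ with adjacency matrix $(a_{ij})$, where $a_{ij}>0$ if there is an edge from $j$ to $i$ and $a_{ij}=0$ otherwise. Assume that $\mathcal G$ is strongly connected and weight-balanced ($\sum_j a_{ij}=\sum_j a_{ji}$ for all $i$). Let $L=\mathrm{diag}\big(\sum_j a_{1j},\dots,\sum_j a_{Nj}\big)-(a_{ij})$ be its Laplacian and $\mathbf L=L\otimes I_n$. Let $f_1,\dots,f_N:\mathbb R^n\to\mathbb R$ be such that $f(\mathbf x)=\sum_{i=1}^N f_i(x_i)$, $\mathbf x=\mathrm{col}(x_1,\dots,x_N)\in\mathbb R^{nN}$, is twice continuously differentiable and $c_0$-strongly convex for some $c_0>0$, and let $\mathbf b\in\mathbb R^{nN}$. For $\varepsilon>0$ consider the algorithm $$\dot{\mathbf x}=-\nabla f(\mathbf x)-\boldsymbol\lambda,\qquad \varepsilon\dot{\boldsymbol\lambda}=-\mathbf L\boldsymbol\lambda+\varepsilon(\mathbf x-\mathbf b),\qquad t\ge 0. \tag{1}$$ An equilibrium of (1) is a pair $(\bar{\mathbf x},\bar{\boldsymbol\lambda})$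 with $\nabla f(\bar{\mathbf x})+\bar{\boldsymbol\lambda}=0$ and $-\varepsilon(\bar{\mathbf x}-\mathbf b)+\mathbf L\bar{\boldsymbol\lambda}=0$. There is $\varepsilon_0>0$ such that for every $\varepsilon\in(0,\varepsilon_0)$ the algorithm (1) has a unique equilibrium $(\bar{\mathbf x}(\varepsilon),\bar{\boldsymbol\lambda}(\varepsilon))$. Moreover, for every $\varepsilon>0$ for which (1) has an equilibrium $(\bar{\mathbf x},\bar{\boldsymbol\lambda})$ (in particular for every $\varepsilon\in(0,\varepsilon_0)$, for any such $\varepsilon_0$), the following hold. 1. From every initial state there is a trajectory of (1) defined for all $t\ge0$, and every trajectory satisfies $(\mathbf x(t),\boldsymbol\lambda(t))\to(\bar{\mathbf x},\bar{\boldsymbol\lambda})$ as $t\to\infty$. 2. If in addition $\nabla f$ is globally $\kappa$-Lipschitz for some $\kappa>0$, the convergence is globally exponential: there are constants $C,\rho>0$ such that every trajectory and every $t\ge0$ satisfy $$\|\mathbf x(t)-\bar{\mathbf x}\|+\|\boldsymbol\lambda(t)-\bar{\boldsymbol\lambda}\|\le C e^{-\rho t}\big(\|\mathbf x(0)-\bar{\mathbf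 x}\|+\|\boldsymbol\lambda(0)-\bar{\boldsymbol\lambda}\|\big).$$ -/

import Mathlib

open Set Filter Topology
open scoped NNReal Kronecker Gradient

/-- A weighted directed graph on the nodes `Fin N`.  `(j, i) ∈ edges` means that agent `j` can send
its information to agent `i`; then `A i j > 0`, and `A i j = 0` otherwise. -/
structure WeightedDigraph (N : ℕ) where
  edges : Set (Fin N × Fin N)
  A : Matrix (Fin N) (Fin N) ℝ
  pos_of_mem : ∀ i j, (j, i) ∈ edges → 0 < A i j
  zero_of_notMem : ∀ i j, (j, i) ∉ edges → A i j = 0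

namespace WeightedDigraph

variable {N : ℕ} (G : WeightedDigraph N)

/-- The weighted in-degree of a node. -/
def inDeg (i : Fin N) : ℝ := ∑ j, G.A i j

/-- The weighted out-degree of a node. -/
def outDeg (i : Fin N) : ℝ := ∑ j, G.A j i

/-- In-degree and out-degree agree at every node. -/
def WeightBalanced : Prop := ∀ i, G.inDeg i = G.outDeg i

/-- There is a directed path from any node to any other node. -/
def StronglyConnected : Prop :=
  ∀ i j, Relation.ReflTransGen (fun u v => (u, v) ∈ G.edges) i j

/-- The in-degree Laplacian `L = D_in - A`. -/
def laplacian : Matrix (Fin N) (Fin N) ℝ := Matrix.diagonal G.inDeg - G.A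

/-- The linear map `L ⊗ I_n` on `ℝ^{nN}`. -/
noncomputable def bigLaplacian (n : ℕ) :
    EuclideanSpace ℝ (Fin N × Fin n) →ₗ[ℝ] EuclideanSpace ℝ (Fin N × Fin n) :=
  Matrix.toEuclideanLin (G.laplacian ⊗ₖ (1 : Matrix (Fin n) (Fin n) ℝ))

end WeightedDigraph

/-- The block `x_i ∈ ℝ^n` of a stacked vector `x = col(x_1, …, x_N) ∈ ℝ^{nN}`. -/
def agentBlock {N n : ℕ} (x : EuclideanSpace ℝ (Fin N × Fin n)) (i : Fin N) :
    EuclideanSpace ℝ (Fin n) :=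
  WithLp.toLp 2 (fun k => x (i, k))

/-- The total cost `f(x) = ∑ i, f_i(x_i)`. -/
def totalCost {N n : ℕ} (f : Fin N → EuclideanSpace ℝ (Fin n) → ℝ)
    (x : EuclideanSpace ℝ (Fin N × Fin n)) : ℝ :=
  ∑ i, f i (agentBlock x i)

/-- `(x, l)` is an equilibrium: `0 = ∇f(x) + l` and `0 = -ε (x - b) + (L ⊗ I_n) l`. -/
def IsEquilibrium {N n : ℕ} (G : WeightedDigraph N) (f : Fin N → EuclideanSpace ℝ (Fin n) → ℝ)
    (b : EuclideanSpace ℝ (Fin N × Fin n)) (ε : ℝ) (x l : EuclideanSpace ℝ (Fin N × Fin n)) :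
    Prop :=
  0 = ∇ (totalCost f) x + l ∧ 0 = -(ε • (x - b)) + G.bigLaplacian n l

/-- `(x(t), l(t))`, `t ≥ 0`, is a trajectory of the algorithm
`x' = -∇f(x) - l`, `ε l' = -(L ⊗ I_n) l + ε (x - b)` (the derivative at `0` is one-sided; the values
at negative times are irrelevant). -/
structure IsTrajectory {N n : ℕ} (G : WeightedDigraph N)
    (f : Fin N → EuclideanSpace ℝ (Fin n) → ℝ) (b : EuclideanSpace ℝ (Fin N × Fin n)) (ε : ℝ)
    (x l : ℝ → EuclideanSpace ℝ (Fin N × Fin n)) : Prop where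
  deriv_x : ∀ t, 0 ≤ t →
    HasDerivWithinAt x (-∇ (totalCost f) (x t) - l t) (Ici 0) t
  deriv_l : ∀ t, 0 ≤ t → ∃ v, HasDerivWithinAt l v (Ici 0) t ∧
    ε • v = -(G.bigLaplacian n (l t)) + ε • (x t - b)

/-!
Write `g = ∇f` and `M = ε⁻¹ (L ⊗ I_n)`. The algorithm is `x' = -g x - l`, `l' = x - b - M l`. Strong
convexity makes `g` strongly monotone with constant `c₀`
(`StrongConvexOn.gradient_strongly_monotone`), and weight balance makes `M` monotone
(`WeightedDigraph.WeightBalanced.inner_bigLaplacian_nonneg`).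

*Equilibria* exist for every `ε > 0`. Eliminating `l = -g x`, one has to solve
`ε (x - b) + L g x = 0`. With an additional term `δ g x` the equation becomes strongly monotone and
Lipschitz in the variable `g x`, hence solvable (`exists_regularized_equilibrium`); its solutions
stay bounded as `δ → 0`, and compactness gives a solution of the original equation
(`exists_equilibrium`). An equilibrium is a constant trajectory, so uniqueness is a consequence of
convergence.

*Stability.* The coupling between `x` and `l` is skew, so `‖x - xbar‖ ^ 2 + ‖l - lbar‖ ^ 2` decreases
along trajectories (`inner_vectorField_le`). This keeps them in compact sets, which gives global
existence (`exists_global_solution_of_inner_nonpos`). A small cross term turns this function into a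
strict Lyapunov function wherever `‖g x - g xbar‖ ≤ κ ‖x - xbar‖` (`exists_exponential_bound`). If
`g` is globally Lipschitz the exponential rate is uniform. Otherwise `g`, being `C¹`, is Lipschitz on
the ball in which a given trajectory stays, and convergence follows (`tendsto_equilibrium`).
-/

/-! ### The gradient of a strongly convex function -/

section StrongConvexity

variable {E : Type*} [NormedAddCommGroup E] [InnerProductSpace ℝ E] [FiniteDimensional ℝ E]
  {φ : E → ℝ} {c : ℝ}

/-- The quadratic lower bound at `x`: divide the strong convexity inequality along the segment from
`x` to `y` by the step length and let that length tend to `0`. -/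
theorem StrongConvexOn.add_inner_gradient_le (hφ : StrongConvexOn univ c φ)
    (hd : Differentiable ℝ φ) (x y : E) :
    φ x + inner ℝ (∇ φ x) (y - x) + c / 2 * ‖y - x‖ ^ 2 ≤ φ y := by
  have hder : HasDerivAt (fun t : ℝ => φ (x + t • (y - x))) (inner ℝ (∇ φ x) (y - x)) 0 := by
    have h1 : HasFDerivAt φ (fderiv ℝ φ x) (x + (0 : ℝ) • (y - x)) := by
      simpa using (hd x).hasFDerivAt
    have h2 : HasDerivAt (fun t : ℝ => x + t • (y - x)) (y - x) 0 := by
      simpa using ((hasDerivAt_id (0 : ℝ)).smul_const (y - x)).const_add x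
    rw [inner_gradient_left]
    exact h1.comp_hasDerivAt 0 h2
  have hlim := (hasDerivAt_iff_tendsto_slope_zero.1 hder).mono_left
    (nhdsWithin_mono (0 : ℝ) (fun t (ht : 0 < t) => ht.ne'))
  have hlim2 : Tendsto (fun t : ℝ => φ y - φ x - (1 - t) * (c / 2 * ‖y - x‖ ^ 2)) (𝓝[>] 0)
      (𝓝 (φ y - φ x - (1 - 0) * (c / 2 * ‖y - x‖ ^ 2))) := by
    apply Tendsto.mono_left _ nhdsWithin_le_nhds
    exact Continuous.tendsto (by fun_prop) 0
  have hle := le_of_tendsto_of_tendsto (b := 𝓝[>] (0 : ℝ)) hlim hlim2 (by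
    filter_upwards [Ioc_mem_nhdsGT (zero_lt_one' ℝ)] with t ht
    have := hφ.2 (mem_univ x) (mem_univ y) (sub_nonneg.2 ht.2) ht.1.le (by ring)
    have e : (1 - t) • x + t • y = x + t • (y - x) := by module
    rw [e, norm_sub_rev] at this
    simp only [smul_eq_mul, zero_add, zero_smul, add_zero] at this ⊢
    rw [inv_mul_le_iff₀ ht.1]
    linarith)
  linarith

theorem StrongConvexOn.gradient_strongly_monotone (hφ : StrongConvexOn univ c φ)
    (hd : Differentiable ℝ φ) (x y : E) :
    c * ‖x - y‖ ^ 2 ≤ inner ℝ (∇ φ x - ∇ φ y) (x - y) := by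
  have h1 := hφ.add_inner_gradient_le hd x y
  have h2 := hφ.add_inner_gradient_le hd y x
  rw [← neg_sub x y, norm_neg, inner_neg_right] at h1
  rw [inner_sub_left]
  linarith

/-- The equation `∇φ x = μ` is the optimality condition of the coercive function `φ - ⟨μ, ·⟩`. -/
theorem StrongConvexOn.gradient_surjective (hφ : StrongConvexOn univ c φ) (hc : 0 < c)
    (hd : Differentiable ℝ φ) : Function.Surjective (∇ φ) := by
  intro μ
  have hcont : Continuous fun x => φ x - inner ℝ μ x :=
    hd.continuous.sub (continuous_const.inner continuous_id)
  have hlim : Tendsto (fun x => φ x - inner ℝ μ x) (cocompact E) atTop := by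
    have h1 : Tendsto (fun r : ℝ => φ 0 + r * (c / 2 * r - ‖∇ φ 0 - μ‖)) atTop atTop := by
      apply tendsto_atTop_add_const_left
      apply tendsto_id.atTop_mul_atTop₀
      apply tendsto_atTop_add_const_right
      exact tendsto_id.const_mul_atTop (by positivity)
    refine tendsto_atTop_mono (fun x => ?_) (h1.comp (tendsto_norm_cocompact_atTop (E := E)))
    have h2 := hφ.add_inner_gradient_le hd 0 x
    have h3 := neg_le_of_abs_le (abs_real_inner_le_norm (∇ φ 0 - μ) x)
    rw [inner_sub_left] at h3
    simp only [sub_zero, Function.comp] at h2 ⊢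
    linarith
  obtain ⟨x, hx⟩ := hcont.exists_forall_le hlim
  refine ⟨x, ?_⟩
  have hmin : IsLocalMin (fun x => φ x - inner ℝ μ x) x := Eventually.of_forall hx
  have hder : HasFDerivAt (fun x => φ x - inner ℝ μ x) (fderiv ℝ φ x - innerSL ℝ μ) x :=
    (hd x).hasFDerivAt.sub (innerSL ℝ μ).hasFDerivAt
  have h0 := hmin.hasFDerivAt_eq_zero hder
  refine ext_inner_right ℝ fun v => ?_
  have := congrArg (fun T : E →L[ℝ] ℝ => T v) h0
  simp only [sub_apply, innerSL_apply_apply, zero_apply] at this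
  rw [inner_gradient_left]
  linarith

theorem ContDiff.gradient_one (hφ : ContDiff ℝ 2 φ) : ContDiff ℝ 1 (∇ φ) := by
  have h : ContDiff ℝ 1 (fderiv ℝ φ) := hφ.fderiv_right (by norm_num)
  exact (InnerProductSpace.toDual ℝ E).symm.contDiff.comp h

end StrongConvexity

/-! ### Existence of equilibria by monotone operator theory -/

section Monotone

variable {E : Type*} [NormedAddCommGroup E] [InnerProductSpace ℝ E]

/-- Zarantonello's theorem: `u ↦ u - s T u` is a contraction for small `s > 0`. -/
theorem exists_eq_zero_of_strongly_monotone_of_lipschitz [CompleteSpace E] {T : E → E} {δ K : ℝ}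
    (hδ : 0 < δ) (hK : ∀ u v, ‖T u - T v‖ ≤ K * ‖u - v‖)
    (hT : ∀ u v, δ * ‖u - v‖ ^ 2 ≤ inner ℝ (T u - T v) (u - v)) : ∃ u, T u = 0 := by
  set M : ℝ := max K δ with hM
  have hMδ : δ ≤ M := le_max_right _ _
  have hM0 : 0 < M := hδ.trans_le hMδ
  -- this step size minimises the squared contraction factor `1 - 2 s δ + s² M²`
  set s : ℝ := δ / M ^ 2 with hs
  have hs0 : 0 < s := by positivity
  set q : ℝ := 1 - δ ^ 2 / M ^ 2 with hq
  have hq0 : 0 ≤ q := by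
    rw [hq, sub_nonneg, div_le_one (by positivity)]
    gcongr
  have hq1 : q < 1 := by
    have : 0 < δ ^ 2 / M ^ 2 := by positivity
    linarith
  have hcon : ContractingWith (Real.toNNReal (√q)) (fun u => u - s • T u) := by
    refine ⟨?_, LipschitzWith.of_dist_le_mul fun u v => ?_⟩
    · rw [← NNReal.coe_lt_coe, Real.coe_toNNReal _ (Real.sqrt_nonneg _), NNReal.coe_one]
      exact (Real.sqrt_lt_sqrt hq0 hq1).trans_eq Real.sqrt_one
    · rw [Real.coe_toNNReal _ (Real.sqrt_nonneg _), dist_eq_norm, dist_eq_norm]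
      apply le_of_sq_le_sq _ (by positivity)
      have e : u - s • T u - (v - s • T v) = (u - v) - s • (T u - T v) := by module
      rw [e, norm_sub_sq_real, mul_pow, Real.sq_sqrt hq0, norm_smul, inner_smul_right,
        real_inner_comm, Real.norm_of_nonneg hs0.le]
      have h1 := hT u v
      have h2 : ‖T u - T v‖ ≤ M * ‖u - v‖ :=
        (hK u v).trans (by gcongr; exact le_max_left _ _)
      have h3 : (s * ‖T u - T v‖) ^ 2 ≤ (s * (M * ‖u - v‖)) ^ 2 := by gcongr
      have h4 : 2 * (s * (δ * ‖u - v‖ ^ 2)) ≤ 2 * (s * inner ℝ (T u - T v) (u - v)) := by gcongr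
      have h5 : (s * (M * ‖u - v‖)) ^ 2 = δ ^ 2 / M ^ 2 * ‖u - v‖ ^ 2 := by
        rw [hs]; field_simp
      have h6 : s * (δ * ‖u - v‖ ^ 2) = δ ^ 2 / M ^ 2 * ‖u - v‖ ^ 2 := by
        rw [hs]; field_simp
      rw [hq]
      linarith
  refine ⟨hcon.fixedPoint, ?_⟩
  have h := hcon.fixedPoint_isFixedPt
  have h' : hcon.fixedPoint - s • T hcon.fixedPoint = hcon.fixedPoint := h
  rw [sub_eq_self, smul_eq_zero] at h'
  exact h'.resolve_left hs0.ne'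

variable {g : E → E} {c : ℝ}

theorem norm_le_of_strongly_monotone
    (hg : ∀ x y, c * ‖x - y‖ ^ 2 ≤ inner ℝ (g x - g y) (x - y)) (x y : E) :
    c * ‖x - y‖ ≤ ‖g x - g y‖ := by
  rcases (norm_nonneg (x - y)).eq_or_lt with h | h
  · rw [← h]; simp
  · have := (hg x y).trans (real_inner_le_norm _ _)
    rw [pow_two, ← mul_assoc] at this
    exact le_of_mul_le_mul_right this h

/-- In the variable `μ = g x` the equation reads `ε (g⁻¹ μ - b) + L μ + δ μ = 0`. Its left-hand side
is Lipschitz, because `g⁻¹` is `1 / c`-Lipschitz, and `δ`-strongly monotone. -/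
theorem exists_regularized_equilibrium [CompleteSpace E] (hc : 0 < c)
    (hg : ∀ x y, c * ‖x - y‖ ^ 2 ≤ inner ℝ (g x - g y) (x - y)) (hsurj : Function.Surjective g)
    (L : E →L[ℝ] E) (hL : ∀ v, 0 ≤ inner ℝ (L v) v) {ε δ : ℝ} (hε : 0 < ε) (hδ : 0 < δ) (b : E) :
    ∃ x, ε • (x - b) + L (g x) + δ • g x = 0 := by
  set h := Function.surjInv hsurj
  have hgh : ∀ μ, g (h μ) = μ := Function.surjInv_eq hsurj
  obtain ⟨μ, hμ⟩ := exists_eq_zero_of_strongly_monotone_of_lipschitz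
    (T := fun μ => ε • (h μ - b) + L μ + δ • μ) (K := ε / c + ‖L‖ + δ) hδ
    (fun u v => by
      have e : ε • (h u - b) + L u + δ • u - (ε • (h v - b) + L v + δ • v)
          = ε • (h u - h v) + L (u - v) + δ • (u - v) := by rw [map_sub]; module
      have h1 : ‖h u - h v‖ ≤ ‖u - v‖ / c := by
        rw [le_div_iff₀' hc]
        simpa only [hgh] using norm_le_of_strongly_monotone hg (h u) (h v)
      rw [e]
      refine (norm_add₃_le).trans ?_
      rw [norm_smul, norm_smul, Real.norm_of_nonneg hε.le, Real.norm_of_nonneg hδ.le]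
      have h2 := L.le_opNorm (u - v)
      have h3 : ε * ‖h u - h v‖ ≤ ε * (‖u - v‖ / c) := by gcongr
      calc _ ≤ ε * (‖u - v‖ / c) + ‖L‖ * ‖u - v‖ + δ * ‖u - v‖ := by gcongr
        _ = _ := by ring)
    (fun u v => by
      have e : ε • (h u - b) + L u + δ • u - (ε • (h v - b) + L v + δ • v)
          = ε • (h u - h v) + L (u - v) + δ • (u - v) := by rw [map_sub]; module
      rw [e, inner_add_left, inner_add_left, inner_smul_left, inner_smul_left,
        real_inner_self_eq_norm_sq]
      have h1 := hg (h u) (h v)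
      rw [hgh, hgh, real_inner_comm] at h1
      have h2 : 0 ≤ c * ‖h u - h v‖ ^ 2 := by positivity
      have h3 := mul_nonneg hε.le (h2.trans h1)
      have h4 := hL (u - v)
      simp only [conj_trivial]
      linarith)
  exact ⟨h μ, by simpa only [hgh] using hμ⟩

/-- Pairing the regularized equation with `g x` bounds its solutions by `‖x - b‖ ≤ ‖g b‖ / c`,
independently of the regularization, so they accumulate at a solution of the limit equation. -/
theorem exists_equilibrium [FiniteDimensional ℝ E] (hc : 0 < c)
    (hg : ∀ x y, c * ‖x - y‖ ^ 2 ≤ inner ℝ (g x - g y) (x - y)) (hsurj : Function.Surjective g)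
    (hcont : Continuous g) (L : E →L[ℝ] E) (hL : ∀ v, 0 ≤ inner ℝ (L v) v) {ε : ℝ} (hε : 0 < ε)
    (b : E) : ∃ x, ε • (x - b) + L (g x) = 0 := by
  have hex : ∀ k : ℕ, ∃ x, ε • (x - b) + L (g x) + (1 / ((k : ℝ) + 1)) • g x = 0 := fun k =>
    exists_regularized_equilibrium hc hg hsurj L hL hε (by positivity) b
  choose x hx using hex
  have hbd : ∀ k, x k ∈ Metric.closedBall b (‖g b‖ / c) := by
    intro k
    rw [mem_closedBall_iff_norm, le_div_iff₀' hc]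
    have h1 := congrArg (fun v => inner ℝ v (g (x k))) (hx k)
    simp only [inner_add_left, inner_smul_left, inner_zero_left, conj_trivial,
      real_inner_self_eq_norm_sq] at h1
    have h2 : 0 ≤ 1 / ((k : ℝ) + 1) * ‖g (x k)‖ ^ 2 := by positivity
    have h3 : ε * inner ℝ (x k - b) (g (x k)) ≤ 0 := by linarith [hL (g (x k))]
    have h4 : inner ℝ (x k - b) (g (x k)) ≤ 0 := by
      by_contra! h
      exact absurd h3 (not_le.2 (mul_pos hε h))
    have h5 := hg (x k) b
    rw [real_inner_comm, inner_sub_right] at h5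
    have h6 := neg_le_of_abs_le (abs_real_inner_le_norm (x k - b) (g b))
    have h7 : c * ‖x k - b‖ ^ 2 ≤ ‖x k - b‖ * ‖g b‖ := by linarith
    rcases (norm_nonneg (x k - b)).eq_or_lt with h | h
    · rw [← h, mul_zero]; positivity
    · apply le_of_mul_le_mul_right _ h
      linarith
  obtain ⟨a, -, ψ, hψ, ha⟩ := (isCompact_closedBall b (‖g b‖ / c)).tendsto_subseq hbd
  refine ⟨a, ?_⟩
  have hga : Tendsto (fun k => g (x (ψ k))) atTop (𝓝 (g a)) := (hcont.tendsto a).comp ha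
  have hz : Tendsto (fun k => (1 / ((ψ k : ℝ) + 1))) atTop (𝓝 0) :=
    tendsto_one_div_add_atTop_nhds_zero_nat.comp hψ.tendsto_atTop
  have hlim : Tendsto (fun k => ε • (x (ψ k) - b) + L (g (x (ψ k)))
      + (1 / ((ψ k : ℝ) + 1)) • g (x (ψ k))) atTop
      (𝓝 (ε • (a - b) + L (g a) + (0 : ℝ) • g a)) :=
    (((ha.sub_const b).const_smul ε).add ((L.continuous.tendsto _).comp hga)).add (hz.smul hga)
  simp only [hx, zero_smul, add_zero] at hlim
  exact (tendsto_nhds_unique hlim tendsto_const_nhds)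

end Monotone

/-! ### Monotonicity of the Laplacian of a weight-balanced digraph -/

section Laplacian

namespace WeightedDigraph

variable {N : ℕ} (G : WeightedDigraph N)

theorem A_nonneg (i j : Fin N) : 0 ≤ G.A i j := by
  by_cases h : (j, i) ∈ G.edges
  · exact (G.pos_of_mem i j h).le
  · exact (G.zero_of_notMem i j h).ge

/-- For a weight-balanced digraph the quadratic form of the Laplacian is
`(1 / 2) ∑ i, ∑ j, a_ij (u_i - u_j) ^ 2`. -/
theorem WeightBalanced.sum_mul_laplacian_mulVec_nonneg {G : WeightedDigraph N}
    (h : G.WeightBalanced) (u : Fin N → ℝ) :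
    0 ≤ ∑ i, (G.inDeg i * u i - ∑ j, G.A i j * u j) * u i := by
  have h1 : ∑ i, ∑ j, G.A i j * u i ^ 2 = ∑ i, G.inDeg i * u i ^ 2 := by
    simp only [inDeg, Finset.sum_mul]
  -- the column sums are out-degrees, and weight balance turns them into in-degrees
  have h2 : ∑ i, ∑ j, G.A i j * u j ^ 2 = ∑ i, G.inDeg i * u i ^ 2 := by
    rw [Finset.sum_comm]
    refine Finset.sum_congr rfl fun i _ => ?_
    rw [h i, outDeg, Finset.sum_mul]
  have h3 : 0 ≤ ∑ i, ∑ j, G.A i j * (u i - u j) ^ 2 :=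
    Finset.sum_nonneg fun i _ => Finset.sum_nonneg fun j _ =>
      mul_nonneg (G.A_nonneg i j) (sq_nonneg _)
  have h4 : ∑ i, ∑ j, G.A i j * (u i - u j) ^ 2 = ∑ i, ∑ j, G.A i j * u i ^ 2
      + ∑ i, ∑ j, G.A i j * u j ^ 2 - 2 * ∑ i, ∑ j, G.A i j * u j * u i := by
    simp only [Finset.mul_sum, ← Finset.sum_add_distrib, ← Finset.sum_sub_distrib]
    exact Finset.sum_congr rfl fun i _ => Finset.sum_congr rfl fun j _ => by ring
  have h5 : ∑ i, (G.inDeg i * u i - ∑ j, G.A i j * u j) * u i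
      = ∑ i, G.inDeg i * u i ^ 2 - ∑ i, ∑ j, G.A i j * u j * u i := by
    rw [← Finset.sum_sub_distrib]
    exact Finset.sum_congr rfl fun i _ => by rw [sub_mul, Finset.sum_mul]; ring
  linarith

theorem bigLaplacian_apply (n : ℕ) (v : EuclideanSpace ℝ (Fin N × Fin n)) (i : Fin N)
    (k : Fin n) :
    G.bigLaplacian n v (i, k) = G.inDeg i * v (i, k) - ∑ j, G.A i j * v (j, k) := by
  simp [bigLaplacian, laplacian, Matrix.toLpLin_apply, Matrix.mulVec, dotProduct,
    Fintype.sum_prod_type, Matrix.one_apply, Matrix.diagonal_apply, sub_mul]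

theorem WeightBalanced.inner_bigLaplacian_nonneg {G : WeightedDigraph N} (h : G.WeightBalanced)
    {n : ℕ} (v : EuclideanSpace ℝ (Fin N × Fin n)) : 0 ≤ inner ℝ (G.bigLaplacian n v) v := by
  rw [real_inner_comm, PiLp.inner_apply, Fintype.sum_prod_type, Finset.sum_comm]
  refine Finset.sum_nonneg fun k _ => ?_
  simpa [bigLaplacian_apply] using h.sum_mul_laplacian_mulVec_nonneg fun i => v (i, k)

end WeightedDigraph

end Laplacian

/-! ### Global solutions of dissipative differential equations -/

section GlobalExistence

/-- If every point of `S` starts a solution on `[0, τ]` that ends in `S`, then concatenating such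
solutions gives one on `[0, ∞)`. -/
theorem exists_global_solution_of_step {H : Type*} [NormedAddCommGroup H] [NormedSpace ℝ H]
    {F : H → H} {S : Set H} {τ : ℝ} (hτ : 0 < τ)
    (hstep : ∀ q ∈ S, ∃ α : ℝ → H, α 0 = q ∧ α τ ∈ S ∧
      ∀ t ∈ Icc 0 τ, HasDerivWithinAt α (F (α t)) (Icc 0 τ) t) {z₀ : H} (hz₀ : z₀ ∈ S) :
    ∃ z : ℝ → H, z 0 = z₀ ∧ ∀ t, 0 ≤ t → HasDerivWithinAt z (F (z t)) (Ici 0) t := by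
  choose! Φ hΦ0 hΦS hΦ using hstep
  -- `q k` is the state reached at time `k τ`
  let q : ℕ → H := fun k => Nat.rec z₀ (fun _ p => Φ p τ) k
  have hqS : ∀ k, q k ∈ S := by
    intro k
    induction k with
    | zero => exact hz₀
    | succ k ih => exact hΦS _ ih
  let z : ℝ → H := fun t => Φ (q ⌊t / τ⌋₊) (t - ⌊t / τ⌋₊ * τ)
  have hz : ∀ k : ℕ, ∀ t ∈ Icc (k * τ) ((k + 1) * τ), z t = Φ (q k) (t - k * τ) := by
    intro k t ht
    rcases ht.2.lt_or_eq with hlt | heq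
    · have : ⌊t / τ⌋₊ = k := by
        rw [Nat.floor_eq_iff (div_nonneg (le_trans (by positivity) ht.1) hτ.le), le_div_iff₀ hτ,
          div_lt_iff₀ hτ]
        exact ⟨ht.1, hlt⟩
      simp only [z, this]
    · have : ⌊t / τ⌋₊ = k + 1 := by
        rw [heq, mul_div_cancel_right₀ _ hτ.ne']
        exact_mod_cast Nat.floor_natCast (R := ℝ) (k + 1)
      have e : t - k * τ = τ := by rw [heq]; ring
      simp only [z, this, e]
      rw [heq]
      push_cast
      rw [sub_self, hΦ0 _ (hqS (k + 1))]
  have hpiece : ∀ k : ℕ, ∀ t ∈ Icc (k * τ) ((k + 1) * τ),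
      HasDerivWithinAt z (F (z t)) (Icc (k * τ) ((k + 1) * τ)) t := by
    intro k t ht
    have hmaps : MapsTo (fun s => s - k * τ) (Icc (k * τ) ((k + 1) * τ)) (Icc 0 τ) := by
      intro s hs
      constructor <;> linarith [hs.1, hs.2]
    have h1 := (hΦ (q k) (hqS k) (t - k * τ) (hmaps ht)).scomp t
      (((hasDerivAt_id t).sub_const (k * τ)).hasDerivWithinAt) hmaps
    rw [one_smul] at h1
    rw [hz k t ht]
    exact h1.congr (hz k) (hz k t ht)
  have hIcc : ∀ k : ℕ, ∀ t ∈ Icc 0 (k * τ), HasDerivWithinAt z (F (z t)) (Icc 0 (k * τ)) t := by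
    intro k
    induction k with
    | zero =>
      intro t ht
      simp only [Nat.cast_zero, zero_mul, Icc_self, mem_singleton_iff] at ht ⊢
      subst ht
      exact HasFDerivWithinAt.of_subsingleton subsingleton_singleton
    | succ k ih =>
      intro t ht
      push_cast at ht ⊢
      have hk : (0 : ℝ) ≤ k * τ := by positivity
      rw [← Icc_union_Icc_eq_Icc hk (by linarith : (k : ℝ) * τ ≤ (k + 1) * τ)]
      apply HasDerivWithinAt.union
      · by_cases h : t ∈ Icc 0 (k * τ)
        · exact ih t h
        · exact HasFDerivWithinAt.of_notMem_closure (by rwa [(isClosed_Icc (α := ℝ)).closure_eq])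
      · by_cases h : t ∈ Icc (k * τ) ((k + 1) * τ)
        · exact hpiece k t h
        · exact HasFDerivWithinAt.of_notMem_closure (by rwa [(isClosed_Icc (α := ℝ)).closure_eq])
  refine ⟨z, ?_, fun t ht => ?_⟩
  · have h0 : z 0 = q 0 := by simpa [hΦ0 _ (hqS 0)] using hz 0 0 (by simp [hτ.le])
    exact h0
  · obtain ⟨k, hk⟩ := exists_nat_gt (t / τ)
    rw [div_lt_iff₀ hτ] at hk
    refine (hIcc k t ⟨ht, hk.le⟩).mono_of_mem_nhdsWithin ?_
    exact inter_mem_nhdsWithin _ (Iic_mem_nhds hk)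

/-- If `F` never points away from `p`, closed balls about `p` are invariant. On a slightly larger
compact ball `F` is bounded and Lipschitz, so the Picard-Lindelöf theorem yields solutions on time
intervals of one common length. -/
theorem exists_global_solution_of_inner_nonpos {H : Type*} [NormedAddCommGroup H]
    [InnerProductSpace ℝ H] [FiniteDimensional ℝ H] {F : H → H} (hF : ContDiff ℝ 1 F) {p : H}
    (hp : ∀ z, inner ℝ (F z) (z - p) ≤ 0) (z₀ : H) :
    ∃ z : ℝ → H, z 0 = z₀ ∧ ∀ t, 0 ≤ t → HasDerivWithinAt z (F (z t)) (Ici 0) t := by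
  set R := ‖z₀ - p‖ with hR
  obtain ⟨K, hK⟩ := hF.contDiffOn.exists_lipschitzOnWith one_ne_zero
    (convex_closedBall p (R + 1)) (isCompact_closedBall p (R + 1))
  obtain ⟨M, hM⟩ := (isCompact_closedBall p (R + 1)).exists_bound_of_continuousOn
    hF.continuous.continuousOn
  set L : ℝ≥0 := Real.toNNReal M + 1 with hL
  have hML : M ≤ L := (Real.le_coe_toNNReal M).trans (by simp [hL])
  have hL0 : (0 : ℝ) < L := by positivity
  have hτ : (0 : ℝ) < 1 / L := by positivity
  refine exists_global_solution_of_step (S := Metric.closedBall p R) hτ (fun q hq => ?_)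
    (by rw [mem_closedBall_iff_norm])
  have hsub : Metric.closedBall q (1 : ℝ≥0) ⊆ Metric.closedBall p (R + 1) :=
    Metric.closedBall_subset_closedBall' (by
      rw [Metric.mem_closedBall] at hq
      push_cast
      linarith)
  have hPL : IsPicardLindelof (fun _ : ℝ => F) (tmin := 0) (tmax := 1 / L)
      ⟨0, left_mem_Icc.2 hτ.le⟩ q 1 0 L K :=
    { lipschitzOnWith := fun _ _ => hK.mono hsub
      continuousOn := fun _ _ => continuousOn_const
      norm_le := fun _ _ x hx => (hM x (hsub hx)).trans hML
      mul_max_le := by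
        rw [sub_zero, sub_self, max_eq_left hτ.le, mul_one_div_cancel hL0.ne']
        simp }
  obtain ⟨α, hα0, hα⟩ := hPL.exists_eq_forall_mem_Icc_hasDerivWithinAt₀
  refine ⟨α, hα0, ?_, hα⟩
  have hder : ∀ t ∈ Icc (0 : ℝ) (1 / L), HasDerivWithinAt (fun t => ‖α t - p‖ ^ 2)
      (2 * inner ℝ (α t - p) (F (α t))) (Icc 0 (1 / L)) t := fun t ht =>
    ((hα t ht).sub_const p).norm_sq
  have hanti : AntitoneOn (fun t => ‖α t - p‖ ^ 2) (Icc (0 : ℝ) (1 / L)) := by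
    refine antitoneOn_of_hasDerivWithinAt_nonpos (convex_Icc _ _)
      (fun t ht => (hder t ht).continuousWithinAt)
      (fun t ht => (hder t (interior_subset ht)).mono interior_subset) (fun t _ => ?_)
    have := hp (α t)
    rw [real_inner_comm] at this
    linarith
  have h1 := hanti (left_mem_Icc.2 hτ.le) (right_mem_Icc.2 hτ.le) hτ.le
  rw [mem_closedBall_iff_norm] at hq ⊢
  simp only [show α 0 = q from hα0] at h1
  exact (le_of_sq_le_sq h1 (norm_nonneg _)).trans hq

end GlobalExistence

/-! ### Stability of the saddle-point dynamics -/

section Lyapunov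

/-- Grönwall's inequality on the half-line for a linear decay rate. -/
theorem le_mul_exp_of_deriv_le_neg_mul {w w' : ℝ → ℝ} {a : ℝ}
    (hw : ∀ t, 0 ≤ t → HasDerivWithinAt w (w' t) (Ici 0) t)
    (hle : ∀ t, 0 ≤ t → w' t ≤ -a * w t) {t : ℝ} (ht : 0 ≤ t) : w t ≤ w 0 * Real.exp (-a * t) := by
  have hder : ∀ s ∈ Ici (0 : ℝ), HasDerivWithinAt (fun s => w s * Real.exp (a * s))
      (w' s * Real.exp (a * s) + w s * (Real.exp (a * s) * (a * 1))) (Ici 0) s := fun s hs =>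
    (hw s hs).mul (((hasDerivAt_id s).const_mul a).exp.hasDerivWithinAt)
  have hanti : AntitoneOn (fun s => w s * Real.exp (a * s)) (Ici (0 : ℝ)) := by
    refine antitoneOn_of_hasDerivWithinAt_nonpos (convex_Ici _)
      (fun s hs => (hder s hs).continuousWithinAt)
      (fun s hs => (hder s (interior_subset hs)).mono interior_subset) (fun s hs => ?_)
    have h1 := mul_le_mul_of_nonneg_right (hle s (interior_subset hs)) (Real.exp_pos (a * s)).le
    linarith
  have h := hanti (self_mem_Ici) ht ht
  simp only [mul_zero, Real.exp_zero, mul_one] at h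
  rw [neg_mul, Real.exp_neg, ← div_eq_mul_inv, le_div_iff₀ (Real.exp_pos _)]
  exact h

variable {E : Type*} [NormedAddCommGroup E] [InnerProductSpace ℝ E]
  {g : E → E} {c : ℝ} {M : E →L[ℝ] E} {b xbar lbar : E}

theorem vectorField_eq_sub_equilibrium (hx0 : g xbar + lbar = 0) (hl0 : xbar - b - M lbar = 0)
    (x l : E) : -g x - l = -(g x - g xbar) - (l - lbar) ∧
      x - b - M l = (x - xbar) - M (l - lbar) := by
  constructor
  · rw [eq_neg_of_add_eq_zero_left hx0]; abel
  · rw [← sub_eq_zero, map_sub, ← hl0]; abel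

/-- Dissipation: the coupling terms `-(l - lbar)` and `x - xbar` cancel in the pairing. -/
theorem inner_vectorField_le (hg : ∀ x y, c * ‖x - y‖ ^ 2 ≤ inner ℝ (g x - g y) (x - y))
    (hM : ∀ v, 0 ≤ inner ℝ (M v) v) (hx0 : g xbar + lbar = 0) (hl0 : xbar - b - M lbar = 0)
    (x l : E) : inner ℝ (-g x - l) (x - xbar) + inner ℝ (x - b - M l) (l - lbar)
      ≤ -(c * ‖x - xbar‖ ^ 2) := by
  obtain ⟨e1, e2⟩ := vectorField_eq_sub_equilibrium hx0 hl0 x l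
  have h1 := hg x xbar
  have h2 := hM (l - lbar)
  rw [e1, e2, inner_sub_left (-(g x - g xbar)), inner_neg_left, inner_sub_left (x - xbar),
    real_inner_comm (x - xbar) (l - lbar)]
  linarith

theorem norm_sq_add_norm_sq_le_of_trajectory (hc : 0 ≤ c)
    (hg : ∀ x y, c * ‖x - y‖ ^ 2 ≤ inner ℝ (g x - g y) (x - y))
    (hM : ∀ v, 0 ≤ inner ℝ (M v) v) (hx0 : g xbar + lbar = 0) (hl0 : xbar - b - M lbar = 0)
    {x l : ℝ → E} (hx : ∀ t, 0 ≤ t → HasDerivWithinAt x (-g (x t) - l t) (Ici 0) t)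
    (hl : ∀ t, 0 ≤ t → HasDerivWithinAt l (x t - b - M (l t)) (Ici 0) t) {t : ℝ} (ht : 0 ≤ t) :
    ‖x t - xbar‖ ^ 2 + ‖l t - lbar‖ ^ 2 ≤ ‖x 0 - xbar‖ ^ 2 + ‖l 0 - lbar‖ ^ 2 := by
  have h := le_mul_exp_of_deriv_le_neg_mul (a := 0)
    (w := fun t => ‖x t - xbar‖ ^ 2 + ‖l t - lbar‖ ^ 2)
    (fun t ht => (((hx t ht).sub_const xbar).norm_sq).add (((hl t ht).sub_const lbar).norm_sq))
    (fun t ht => by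
      have h1 := inner_vectorField_le hg hM hx0 hl0 (x t) (l t)
      have h2 : 0 ≤ c * ‖x t - xbar‖ ^ 2 := by positivity
      rw [real_inner_comm (-g (x t) - l t), real_inner_comm (x t - b - M (l t))]
      linarith) ht
  simpa using h

/-- The constants depend on the trajectory only through `κ`, a bound for the growth of `g` about
`xbar` along it. The plain squared distance to the equilibrium does not dissipate in `l`; adding
the cross term `δ ⟨x - xbar, l - lbar⟩` to it gives a strict Lyapunov function. -/
theorem exists_exponential_bound (hc : 0 < c)
    (hg : ∀ x y, c * ‖x - y‖ ^ 2 ≤ inner ℝ (g x - g y) (x - y))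
    (hM : ∀ v, 0 ≤ inner ℝ (M v) v) (hx0 : g xbar + lbar = 0) (hl0 : xbar - b - M lbar = 0)
    {κ : ℝ} (hκ : 0 ≤ κ) :
    ∃ C ρ : ℝ, 0 < C ∧ 0 < ρ ∧ ∀ x l : ℝ → E,
      (∀ t, 0 ≤ t → HasDerivWithinAt x (-g (x t) - l t) (Ici 0) t) →
      (∀ t, 0 ≤ t → HasDerivWithinAt l (x t - b - M (l t)) (Ici 0) t) →
      (∀ t, 0 ≤ t → ‖g (x t) - g xbar‖ ≤ κ * ‖x t - xbar‖) →
      ∀ t, 0 ≤ t → ‖x t - xbar‖ + ‖l t - lbar‖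
        ≤ C * Real.exp (-ρ * t) * (‖x 0 - xbar‖ + ‖l 0 - lbar‖) := by
  set K : ℝ := κ + ‖M‖ with hK
  have hK0 : 0 ≤ K := by positivity
  -- `δ ≤ 1 / 2` keeps the Lyapunov function comparable to the squared distance; the cross term
  -- contributes `-δ ‖l - lbar‖ ^ 2` to its derivative, at the cost of terms that are at most
  -- `δ (1 + K ^ 2 / 2) ‖x - xbar‖ ^ 2 + δ / 2 * ‖l - lbar‖ ^ 2`
  set δ : ℝ := c / (2 * (1 + c + K ^ 2)) with hδ
  have hδ0 : 0 < δ := by positivity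
  have hδ1 : δ * (1 + c + K ^ 2) = c / 2 := by rw [hδ]; field_simp
  have hδ2 : δ ≤ 1 / 2 := by
    rw [hδ, div_le_div_iff₀ (by positivity) (by positivity)]
    nlinarith [sq_nonneg K]
  refine ⟨3, δ / 3, by norm_num, by positivity, fun x l hx hl hκx t ht => ?_⟩
  have hcross : ∀ t, |δ * inner ℝ (x t - xbar) (l t - lbar)|
      ≤ 1 / 4 * (‖x t - xbar‖ ^ 2 + ‖l t - lbar‖ ^ 2) := by
    intro t
    rw [abs_mul, abs_of_pos hδ0]
    have h1 := abs_real_inner_le_norm (x t - xbar) (l t - lbar)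
    have h2 := mul_le_mul hδ2 h1 (abs_nonneg _) (by norm_num)
    linarith [two_mul_le_add_sq ‖x t - xbar‖ ‖l t - lbar‖]
  have hdecay := le_mul_exp_of_deriv_le_neg_mul (a := 2 * δ / 3)
    (w := fun t => 1 / 2 * (‖x t - xbar‖ ^ 2 + ‖l t - lbar‖ ^ 2)
      + δ * inner ℝ (x t - xbar) (l t - lbar))
    (fun t ht => (((((hx t ht).sub_const xbar).norm_sq).add
      (((hl t ht).sub_const lbar).norm_sq)).const_mul (1 / 2)).add
      ((((hx t ht).sub_const xbar).inner ℝ ((hl t ht).sub_const lbar)).const_mul δ))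
    (fun t ht => by
      obtain ⟨e1, e2⟩ := vectorField_eq_sub_equilibrium hx0 hl0 (x t) (l t)
      have h1 := hg (x t) xbar
      have h2 := hM (l t - lbar)
      have h3 := hκx t ht
      have h4 := hcross t
      rw [e1, e2]
      generalize x t - xbar = u at *
      generalize l t - lbar = v at *
      generalize g (x t) - g xbar = d at *
      simp only [inner_sub_right, inner_sub_left, inner_neg_right, inner_neg_left,
        real_inner_self_eq_norm_sq]
      rw [real_inner_comm u v, real_inner_comm d u, real_inner_comm (M v) v]
      have h5 := neg_le_of_abs_le (abs_real_inner_le_norm d v)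
      have h6 := neg_le_of_abs_le (abs_real_inner_le_norm u (M v))
      have h7 : ‖d‖ * ‖v‖ ≤ κ * ‖u‖ * ‖v‖ := by gcongr
      have h8 : ‖u‖ * ‖M v‖ ≤ ‖u‖ * (‖M‖ * ‖v‖) := by gcongr; exact M.le_opNorm v
      have h9 : K * ‖u‖ * ‖v‖ ≤ 1 / 2 * (K ^ 2 * ‖u‖ ^ 2 + ‖v‖ ^ 2) := by
        nlinarith [sq_nonneg (K * ‖u‖ - ‖v‖)]
      have h10 : -inner ℝ d v - inner ℝ u (M v) ≤ 1 / 2 * (K ^ 2 * ‖u‖ ^ 2 + ‖v‖ ^ 2) := by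
        have : K * ‖u‖ * ‖v‖ = κ * ‖u‖ * ‖v‖ + ‖u‖ * (‖M‖ * ‖v‖) := by rw [hK]; ring
        linarith
      have h11 := mul_le_mul_of_nonneg_left h10 hδ0.le
      have h12 := mul_le_mul_of_nonneg_left (le_of_abs_le h4) hδ0.le
      have h13 : c / 2 * ‖u‖ ^ 2 = δ * ‖u‖ ^ 2 + δ * c * ‖u‖ ^ 2 + δ * (K ^ 2 * ‖u‖ ^ 2) := by
        rw [← hδ1]; ring
      have h14 : 0 ≤ δ * c * ‖u‖ ^ 2 := by positivity
      have h15 : 0 ≤ δ * (K ^ 2 * ‖u‖ ^ 2) := by positivity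
      have h16 : 0 ≤ δ * ‖u‖ ^ 2 := by positivity
      linarith) ht
  have h1 := neg_le_of_abs_le (hcross t)
  have h2 := le_of_abs_le (hcross 0)
  have hexp : 0 < Real.exp (-(2 * δ / 3) * t) := Real.exp_pos _
  set a := ‖x t - xbar‖
  set a' := ‖l t - lbar‖
  set a₀ := ‖x 0 - xbar‖
  set a₀' := ‖l 0 - lbar‖
  have ha₀ : 0 ≤ a₀ := norm_nonneg _
  have ha₀' : 0 ≤ a₀' := norm_nonneg _
  have h3 : a ^ 2 + a' ^ 2 ≤ 3 * (a₀ ^ 2 + a₀' ^ 2) * Real.exp (-(2 * δ / 3) * t) := by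
    have := mul_le_mul_of_nonneg_right (show 1 / 2 * (a₀ ^ 2 + a₀' ^ 2)
      + δ * inner ℝ (x 0 - xbar) (l 0 - lbar) ≤ 3 / 4 * (a₀ ^ 2 + a₀' ^ 2) by linarith) hexp.le
    linarith
  apply le_of_sq_le_sq _ (by positivity)
  have h4 : Real.exp (-(2 * δ / 3) * t) = Real.exp (-(δ / 3) * t) ^ 2 := by
    rw [pow_two, ← Real.exp_add]; ring_nf
  rw [h4] at h3
  have h5 : (a₀ ^ 2 + a₀' ^ 2) * Real.exp (-(δ / 3) * t) ^ 2
      ≤ (a₀ + a₀') ^ 2 * Real.exp (-(δ / 3) * t) ^ 2 := by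
    gcongr
    nlinarith [mul_nonneg ha₀ ha₀']
  have h6 : 0 ≤ (a₀ + a₀') ^ 2 * Real.exp (-(δ / 3) * t) ^ 2 := by positivity
  rw [mul_pow, mul_pow]
  linarith [add_sq_le (a := a) (b := a')]

/-- A trajectory stays in a ball about the equilibrium, on which `g` is Lipschitz; so it converges
exponentially, at a rate that may depend on that ball. -/
theorem tendsto_equilibrium [FiniteDimensional ℝ E] (hc : 0 < c)
    (hg : ∀ x y, c * ‖x - y‖ ^ 2 ≤ inner ℝ (g x - g y) (x - y)) (hg1 : ContDiff ℝ 1 g)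
    (hM : ∀ v, 0 ≤ inner ℝ (M v) v) (hx0 : g xbar + lbar = 0) (hl0 : xbar - b - M lbar = 0)
    {x l : ℝ → E} (hx : ∀ t, 0 ≤ t → HasDerivWithinAt x (-g (x t) - l t) (Ici 0) t)
    (hl : ∀ t, 0 ≤ t → HasDerivWithinAt l (x t - b - M (l t)) (Ici 0) t) :
    Tendsto x atTop (𝓝 xbar) ∧ Tendsto l atTop (𝓝 lbar) := by
  set R : ℝ := √(‖x 0 - xbar‖ ^ 2 + ‖l 0 - lbar‖ ^ 2)
  obtain ⟨κ, hκ⟩ := hg1.contDiffOn.exists_lipschitzOnWith one_ne_zero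
    (convex_closedBall xbar R) (isCompact_closedBall xbar R)
  have hxR : ∀ t, 0 ≤ t → x t ∈ Metric.closedBall xbar R := fun t ht => by
    rw [mem_closedBall_iff_norm]
    apply Real.le_sqrt_of_sq_le
    have := norm_sq_add_norm_sq_le_of_trajectory hc.le hg hM hx0 hl0 hx hl ht
    linarith [sq_nonneg ‖l t - lbar‖]
  obtain ⟨C, ρ, -, hρ, hbound⟩ := exists_exponential_bound hc hg hM hx0 hl0 κ.coe_nonneg
  have hb := hbound x l hx hl fun t ht => by
    simpa only [dist_eq_norm] using hκ.dist_le_mul (x t) (hxR t ht) xbar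
      (Metric.mem_closedBall_self (Real.sqrt_nonneg _))
  have hexp : Tendsto (fun t => C * Real.exp (-ρ * t) * (‖x 0 - xbar‖ + ‖l 0 - lbar‖)) atTop
      (𝓝 0) := by
    have h1 : Tendsto (fun t : ℝ => -ρ * t) atTop atBot :=
      tendsto_id.const_mul_atTop_of_neg (by linarith)
    simpa using ((Real.tendsto_exp_atBot.comp h1).const_mul C).mul_const
      (‖x 0 - xbar‖ + ‖l 0 - lbar‖)
  constructor
  · rw [tendsto_iff_norm_sub_tendsto_zero]
    refine squeeze_zero' (Eventually.of_forall fun t => norm_nonneg _) ?_ hexp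
    filter_upwards [eventually_ge_atTop 0] with t ht
    linarith [hb t ht, norm_nonneg (l t - lbar)]
  · rw [tendsto_iff_norm_sub_tendsto_zero]
    refine squeeze_zero' (Eventually.of_forall fun t => norm_nonneg _) ?_ hexp
    filter_upwards [eventually_ge_atTop 0] with t ht
    linarith [hb t ht, norm_nonneg (x t - xbar)]

/-- The state space `E × E` is given its Euclidean norm, for which the field is dissipative. -/
theorem exists_trajectory [FiniteDimensional ℝ E] (hc : 0 ≤ c)
    (hg : ∀ x y, c * ‖x - y‖ ^ 2 ≤ inner ℝ (g x - g y) (x - y)) (hg1 : ContDiff ℝ 1 g)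
    (hM : ∀ v, 0 ≤ inner ℝ (M v) v) (hx0 : g xbar + lbar = 0) (hl0 : xbar - b - M lbar = 0)
    (x₀ l₀ : E) :
    ∃ x l : ℝ → E, (∀ t, 0 ≤ t → HasDerivWithinAt x (-g (x t) - l t) (Ici 0) t) ∧
      (∀ t, 0 ≤ t → HasDerivWithinAt l (x t - b - M (l t)) (Ici 0) t) ∧ x 0 = x₀ ∧ l 0 = l₀ := by
  let P := WithLp.prodContinuousLinearEquiv 2 ℝ E E
  let F : WithLp 2 (E × E) → WithLp 2 (E × E) := fun z =>
    P.symm (-g (P z).1 - (P z).2, (P z).1 - b - M (P z).2)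
  have hF : ContDiff ℝ 1 F := by
    have h1 : ContDiff ℝ 1 fun z => (P z).1 := contDiff_fst.comp P.contDiff
    have h2 : ContDiff ℝ 1 fun z => (P z).2 := contDiff_snd.comp P.contDiff
    exact P.symm.contDiff.comp
      (((hg1.comp h1).neg.sub h2).prodMk ((h1.sub contDiff_const).sub (M.contDiff.comp h2)))
  obtain ⟨z, hz0, hz⟩ := exists_global_solution_of_inner_nonpos hF (p := P.symm (xbar, lbar))
    (fun z => by
      have h1 := inner_vectorField_le hg hM hx0 hl0 (P z).1 (P z).2
      have h2 : 0 ≤ c * ‖(P z).1 - xbar‖ ^ 2 := by positivity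
      rw [WithLp.prod_inner_apply]
      change inner ℝ (-g (P z).1 - (P z).2) ((P z).1 - xbar)
        + inner ℝ ((P z).1 - b - M (P z).2) ((P z).2 - lbar) ≤ 0
      linarith) (P.symm (x₀, l₀))
  have hPz : ∀ t, 0 ≤ t → HasDerivWithinAt (fun t => P (z t)) (P (F (z t))) (Ici 0) t :=
    fun t ht => P.hasFDerivAt.comp_hasDerivWithinAt t (hz t ht)
  refine ⟨fun t => (P (z t)).1, fun t => (P (z t)).2, fun t ht => ?_, fun t ht => ?_, ?_, ?_⟩
  · exact (ContinuousLinearMap.fst ℝ E E).hasFDerivAt.comp_hasDerivWithinAt t (hPz t ht)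
  · exact (ContinuousLinearMap.snd ℝ E E).hasFDerivAt.comp_hasDerivWithinAt t (hPz t ht)
  · simp [hz0]
  · simp [hz0]

end Lyapunov

/-! ### The distributed algorithm -/

/-- After division by `ε`, an equilibrium is a zero of the field `(-g x - l, x - b - M l)` with
`g = ∇f` and `M = ε⁻¹ (L ⊗ I_n)`. -/
theorem isEquilibrium_iff {N n : ℕ} {G : WeightedDigraph N}
    {f : Fin N → EuclideanSpace ℝ (Fin n) → ℝ} {b : EuclideanSpace ℝ (Fin N × Fin n)} {ε : ℝ}
    (hε : 0 < ε) {x l : EuclideanSpace ℝ (Fin N × Fin n)} :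
    IsEquilibrium G f b ε x l ↔ ∇ (totalCost f) x + l = 0 ∧
      x - b - (ε⁻¹ • (G.bigLaplacian n).toContinuousLinearMap) l = 0 := by
  refine and_congr eq_comm ?_
  rw [← smul_eq_zero_iff_right hε.ne', eq_comm, ← neg_eq_zero]
  simp only [FunLike.coe_smul, Pi.smul_apply, LinearMap.coe_toContinuousLinearMap', smul_sub,
    smul_inv_smul₀ hε.ne', neg_add_rev, neg_neg]
  rw [add_comm, ← sub_eq_add_neg]

/-- After division by `ε`, a trajectory is an integral curve of the field
`(-g x - l, x - b - M l)` with `g = ∇f` and `M = ε⁻¹ (L ⊗ I_n)`. -/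
theorem isTrajectory_iff {N n : ℕ} {G : WeightedDigraph N}
    {f : Fin N → EuclideanSpace ℝ (Fin n) → ℝ} {b : EuclideanSpace ℝ (Fin N × Fin n)} {ε : ℝ}
    (hε : 0 < ε) {x l : ℝ → EuclideanSpace ℝ (Fin N × Fin n)} :
    IsTrajectory G f b ε x l ↔
      (∀ t, 0 ≤ t → HasDerivWithinAt x (-∇ (totalCost f) (x t) - l t) (Ici 0) t) ∧
      (∀ t, 0 ≤ t → HasDerivWithinAt l
        (x t - b - (ε⁻¹ • (G.bigLaplacian n).toContinuousLinearMap) (l t)) (Ici 0) t) := by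
  have key : ∀ t v, ε • v = -(G.bigLaplacian n (l t)) + ε • (x t - b) ↔
      v = x t - b - (ε⁻¹ • (G.bigLaplacian n).toContinuousLinearMap) (l t) := by
    intro t v
    rw [← smul_right_injective _ hε.ne' |>.eq_iff (a := v)]
    simp only [FunLike.coe_smul, Pi.smul_apply, LinearMap.coe_toContinuousLinearMap', smul_sub,
      smul_inv_smul₀ hε.ne']
    rw [neg_add_eq_sub]
  constructor
  · rintro ⟨hx, hl⟩
    refine ⟨hx, fun t ht => ?_⟩
    obtain ⟨v, hv, hv'⟩ := hl t ht
    rwa [← (key t v).1 hv']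
  · rintro ⟨hx, hl⟩
    exact ⟨hx, fun t ht => ⟨_, hl t ht, (key t _).2 rfl⟩⟩

theorem theorem2 {N n : ℕ} (G : WeightedDigraph N)
    (hconn : G.StronglyConnected) (hbal : G.WeightBalanced)
    (f : Fin N → EuclideanSpace ℝ (Fin n) → ℝ)
    (c₀ : ℝ) (hc₀ : 0 < c₀) (hconv : StrongConvexOn univ c₀ (totalCost f))
    (hsmooth : ContDiff ℝ 2 (totalCost f))
    (b : EuclideanSpace ℝ (Fin N × Fin n)) :
    -- for all small `ε > 0` there is exactly one equilibrium
    (∃ ε₀ : ℝ, 0 < ε₀ ∧ ∀ ε : ℝ, 0 < ε → ε < ε₀ →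
      ∃! p : EuclideanSpace ℝ (Fin N × Fin n) × EuclideanSpace ℝ (Fin N × Fin n),
        IsEquilibrium G f b ε p.1 p.2) ∧
    -- whenever `ε > 0` and there is an equilibrium (so for every `ε < ε₀`, for any such `ε₀`)
    (∀ ε : ℝ, 0 < ε → ∀ xbar lbar : EuclideanSpace ℝ (Fin N × Fin n),
      IsEquilibrium G f b ε xbar lbar →
      -- a trajectory exists from every initial state
      (∀ x₀ l₀ : EuclideanSpace ℝ (Fin N × Fin n),
        ∃ x l : ℝ → EuclideanSpace ℝ (Fin N × Fin n),
          IsTrajectory G f b ε x l ∧ x 0 = x₀ ∧ l 0 = l₀) ∧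
      -- every trajectory converges to the equilibrium
      (∀ x l : ℝ → EuclideanSpace ℝ (Fin N × Fin n), IsTrajectory G f b ε x l →
        Tendsto x atTop (𝓝 xbar) ∧ Tendsto l atTop (𝓝 lbar)) ∧
      -- global exponential convergence if the gradient is globally Lipschitz
      ((∃ κ : ℝ≥0, 0 < κ ∧ LipschitzWith κ (∇ (totalCost f))) →
        ∃ C ρ : ℝ, 0 < C ∧ 0 < ρ ∧
          ∀ x l : ℝ → EuclideanSpace ℝ (Fin N × Fin n), IsTrajectory G f b ε x l →
            ∀ t : ℝ, 0 ≤ t →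
              ‖x t - xbar‖ + ‖l t - lbar‖ ≤
                C * Real.exp (-ρ * t) * (‖x 0 - xbar‖ + ‖l 0 - lbar‖))) := by
  have hd : Differentiable ℝ (totalCost f) := hsmooth.differentiable (by norm_num)
  have hg := hconv.gradient_strongly_monotone hd
  have hg1 := hsmooth.gradient_one
  have hM : ∀ ε : ℝ, 0 < ε → ∀ v,
      0 ≤ inner ℝ ((ε⁻¹ • (G.bigLaplacian n).toContinuousLinearMap) v) v := by
    intro ε hε v
    simp only [FunLike.coe_smul, Pi.smul_apply, LinearMap.coe_toContinuousLinearMap',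
      inner_smul_left, conj_trivial]
    exact mul_nonneg (inv_nonneg.2 hε.le) (hbal.inner_bigLaplacian_nonneg v)
  have htend : ∀ ε : ℝ, 0 < ε → ∀ xbar lbar, IsEquilibrium G f b ε xbar lbar →
      ∀ x l, IsTrajectory G f b ε x l → Tendsto x atTop (𝓝 xbar) ∧ Tendsto l atTop (𝓝 lbar) := by
    intro ε hε xbar lbar heq x l htraj
    obtain ⟨hx0, hl0⟩ := (isEquilibrium_iff hε).1 heq
    obtain ⟨hx, hl⟩ := (isTrajectory_iff hε).1 htraj
    exact tendsto_equilibrium hc₀ hg hg1 (hM ε hε) hx0 hl0 hx hl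
  refine ⟨⟨1, one_pos, fun ε hε _ => ?_⟩, fun ε hε xbar lbar heq => ⟨?_, htend ε hε xbar lbar heq,
    ?_⟩⟩
  · obtain ⟨x, hx⟩ := exists_equilibrium hc₀ hg (hconv.gradient_surjective hc₀ hd) hg1.continuous
      (G.bigLaplacian n).toContinuousLinearMap hbal.inner_bigLaplacian_nonneg hε b
    have hex : IsEquilibrium G f b ε x (-∇ (totalCost f) x) := by
      refine ⟨(add_neg_cancel _).symm, ?_⟩
      rw [map_neg, ← neg_add]
      exact (neg_eq_zero.2 hx).symm
    refine ⟨(x, -∇ (totalCost f) x), hex, fun p hp => ?_⟩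
    -- an equilibrium is a constant trajectory, hence converges to any other equilibrium
    have hconst : IsTrajectory G f b ε (fun _ => p.1) (fun _ => p.2) := by
      obtain ⟨h1, h2⟩ := (isEquilibrium_iff hε).1 hp
      refine (isTrajectory_iff hε).2 ⟨fun t _ => ?_, fun t _ => ?_⟩
      · rw [← neg_add', h1, neg_zero]
        exact hasDerivWithinAt_const _ _ _
      · rw [h2]
        exact hasDerivWithinAt_const _ _ _
    obtain ⟨h1, h2⟩ := htend ε hε _ _ hex _ _ hconst
    exact Prod.ext (tendsto_nhds_unique tendsto_const_nhds h1)
      (tendsto_nhds_unique tendsto_const_nhds h2)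
  · intro x₀ l₀
    obtain ⟨hx0, hl0⟩ := (isEquilibrium_iff hε).1 heq
    obtain ⟨x, l, hx, hl, h0⟩ := exists_trajectory hc₀.le hg hg1 (hM ε hε) hx0 hl0 x₀ l₀
    exact ⟨x, l, (isTrajectory_iff hε).2 ⟨hx, hl⟩, h0⟩
  · rintro ⟨κ, -, hκ⟩
    obtain ⟨hx0, hl0⟩ := (isEquilibrium_iff hε).1 heq
    obtain ⟨C, ρ, hC, hρ, h⟩ := exists_exponential_bound hc₀ hg (hM ε hε) hx0 hl0 κ.coe_nonneg
    refine ⟨C, ρ, hC, hρ, fun x l htraj => ?_⟩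
    obtain ⟨hx, hl⟩ := (isTrajectory_iff hε).1 htraj
    exact h x l hx hl fun t _ => hκ.norm_sub_le (x t) xbar
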